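/- Let $k$ be a field with algebraic closure $\overline{k}$, and let $n\ge 3$. For a field $F$, the commuting graph over $F$ has as vertices the non-scalar $n\times n$ matrices over $F$ (those that are not constant multiples of the identity), two distinct vertices being adjacent exactly when they commute. For $A,B\in\mathrm{Mat}_{n\times n}(F)$ let the commuting distance $d_F(A,B)\in\{0,1,2,\dots\}\cup\{\infty\}$ be the distance of $A$ and $B$ in this graph if both are non-scalar ($\infty$ if they lie in different components); if $A$ or $B$ is scalar, put $d_F(A,B)=0$ when $A=B$ and $d_F(A,B)=1$ when $A\ne B$. Let $\mathcal{C}^3_n(F)=\{(A,B)\in\mathrm{Mat}_{n\times n}(F)^2 : d_F(A,B)\le 3\}$. Suppose that $d_k(A,B)=d_{\overline{k}}(A,B)$ for all $(A,B)\in\mathrm{Mat}_{n\times n}(k)^2$. Then $\mathcal{C}^3_n(k)$ is an affine variety in the $2n^2$-dimensional affine space $\mathrm{Mat}_{n\times n}(k)^2\cong k^{2n^2}$; that is, it is the set of common zeros in $k^{2n^2}$ of finitely many polynomials with coefficients in $k$. Moreover, $\mathcal{C}^3_n(k)=\mathcal{C}^3_n(\overline{k})\cap\mathrm{Mat}_{n\times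 n}(k)^2$. -/

import Mathlib

namespace CommDist

open scoped Matrix

/-- A subset of the affine space `σ → k` is an affine variety if it is the set of common zeros
of finitely many polynomials with coefficients in `k`. -/
def IsAffineVariety {σ k : Type*} [Field k] (V : Set (σ → k)) : Prop :=
  ∃ F : Finset (MvPolynomial σ k), V = {x | ∀ f ∈ F, MvPolynomial.eval x f = 0}

/-- The set of coordinates on pairs of `n × n` matrices: `Sum.inl (i, j)` is the `(i, j)` entry of
the first matrix and `Sum.inr (i, j)` is the `(i, j)` entry of the second one. -/
abbrev PairIndex (n : ℕ) : Type := (Fin n × Fin n) ⊕ (Fin n × Fin n)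

/-- The identification of pairs of `n × n` matrices with points of the affine space of
dimension `2 n ^ 2`. -/
def pairCoords (n : ℕ) (k : Type*) :
    Matrix (Fin n) (Fin n) k × Matrix (Fin n) (Fin n) k ≃ (PairIndex n → k) where
  toFun P := Sum.elim (fun ij => P.1 ij.1 ij.2) (fun ij => P.2 ij.1 ij.2)
  invFun x := (Matrix.of fun i j => x (Sum.inl (i, j)), Matrix.of fun i j => x (Sum.inr (i, j)))
  left_inv _ := rfl
  right_inv x := by
    funext s
    rcases s with ⟨i, j⟩ | ⟨i, j⟩ <;> rfl

/-- A matrix is scalar if it is a constant multiple of the identity. -/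
def IsScalar {n : ℕ} {k : Type*} [Field k] (A : Matrix (Fin n) (Fin n) k) : Prop :=
  ∃ c : k, A = c • (1 : Matrix (Fin n) (Fin n) k)

/-- The commuting graph: its vertices are the non-scalar `n × n` matrices over `k`, and two
different vertices are adjacent if and only if they commute. -/
def commGraph (n : ℕ) (k : Type*) [Field k] :
    SimpleGraph {A : Matrix (Fin n) (Fin n) k // ¬ IsScalar A} where
  Adj A B := A ≠ B ∧ A.1 * B.1 = B.1 * A.1
  symm := ⟨fun _ _ h => ⟨h.1.symm, h.2.symm⟩⟩
  loopless := ⟨fun _ h => h.1 rfl⟩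

open Classical in
/-- The commuting distance of two matrices over `k`, with values in `ℕ ∪ {∞}`. For non-scalar
matrices it is the distance in the commuting graph (`⊤` in different components); if one of the
matrices is scalar, it is `0` for equal and `1` for different matrices. -/
noncomputable def commDist {n : ℕ} {k : Type*} [Field k] (A B : Matrix (Fin n) (Fin n) k) : ℕ∞ :=
  if h : ¬ IsScalar A ∧ ¬ IsScalar B then (commGraph n k).edist ⟨A, h.1⟩ ⟨B, h.2⟩
  else if A = B then 0 else 1

/-- The distance-`d` commuting set of pairs of `n × n` matrices over `k`. -/
def commSet (n : ℕ) (k : Type*) [Field k] (d : ℕ) :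
    Set (Matrix (Fin n) (Fin n) k × Matrix (Fin n) (Fin n) k) :=
  {P | commDist P.1 P.2 ≤ (d : ℕ∞)}

end CommDist

/-!
The second claim is a rewriting of the hypothesis on distances, and it exhibits the pairs at
distance at most three over `k` as the `k`-rational points of the same set over the algebraic
closure `K`. Rational points of a variety over `K` form a variety over `k`
(`CommDist.IsAffineVariety.rationalPoints`), so it remains to see that the set is closed over `K`.

There, `A` and `B` are at distance at most three if and only if there are non-scalar `X` and `Y`
such that consecutive terms of `A, X, Y, B` commute (`CommDist.commDist_le_three_iff`); this also
holds if `A` or `B` is scalar. Modulo scalar matrices `X` and `Y` are nonzero, and commutation is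
invariant under scaling them, so the set in question is the projection of a closed subset of
`K^(2n²) × ℙ × ℙ`, with `ℙ` the projective space of `Matrix / scalars`. It is closed by the main
theorem of elimination theory, applied once for `Y` and once for `X`
(`CommDist.IsAffineVariety.exists_ne_zero`).

The elimination theorem is proved for a closed family `Z` of cones. If the fibre of `Z` over a
parameter `a` is trivial, then by the Nullstellensatz all monomials of some degree `D` are
specializations at `a` of forms vanishing on `Z`. The determinant of the coefficient matrix of these
forms is a polynomial in the parameters, which is `1` at `a` and is zero wherever the fibre of `Z`
is nontrivial.
-/

namespace CommDist

open MvPolynomial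

/-! ### Zariski closed sets -/

/-- A set is an affine variety as soon as every point outside it is separated from it by one
polynomial: by the Hilbert basis theorem its vanishing ideal is finitely generated. -/
theorem isAffineVariety_of_separating {σ k : Type*} [Field k] [Finite σ] {V : Set (σ → k)}
    (h : ∀ a ∉ V, ∃ f : MvPolynomial σ k, (∀ x ∈ V, eval x f = 0) ∧ eval a f ≠ 0) :
    IsAffineVariety V := by
  obtain ⟨F, hF⟩ := (isNoetherianRing_iff_ideal_fg _).1
    (inferInstance : IsNoetherianRing (MvPolynomial σ k)) (vanishingIdeal k V)
  have hFV : ∀ f ∈ F, ∀ x ∈ V, eval x f = 0 := fun f hf x hx ↦ by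
    have : f ∈ vanishingIdeal k V := hF ▸ Ideal.subset_span hf
    simpa [aeval_eq_eval] using this x hx
  refine ⟨F, Set.Subset.antisymm (fun x hx f hf ↦ hFV f hf x hx) fun a ha ↦ ?_⟩
  by_contra haV
  obtain ⟨f, hfV, hfa⟩ := h a haV
  have hf : f ∈ Ideal.span (F : Set (MvPolynomial σ k)) := by
    rw [hF]
    intro x hx
    simpa [aeval_eq_eval] using hfV x hx
  have hle : Ideal.span (F : Set (MvPolynomial σ k)) ≤ RingHom.ker (eval a) :=
    Ideal.span_le.2 fun f hf ↦ ha f hf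
  exact hfa (hle hf)

theorem isAffineVariety_setOf_forall {ι σ k : Type*} [Field k] [Finite σ]
    (f : ι → MvPolynomial σ k) : IsAffineVariety {x | ∀ i, eval x (f i) = 0} := by
  refine isAffineVariety_of_separating fun a ha ↦ ?_
  simp only [Set.mem_ofPred_eq, not_forall] at ha
  obtain ⟨i, hi⟩ := ha
  exact ⟨f i, fun x hx ↦ hx i, hi⟩

theorem IsAffineVariety.exists_separating {σ k : Type*} [Field k] {V : Set (σ → k)}
    (hV : IsAffineVariety V) {a : σ → k} (ha : a ∉ V) :
    ∃ f : MvPolynomial σ k, (∀ x ∈ V, eval x f = 0) ∧ eval a f ≠ 0 := by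
  obtain ⟨F, rfl⟩ := hV
  simp only [Set.mem_ofPred_eq, not_forall] at ha
  obtain ⟨f, hf, hfa⟩ := ha
  exact ⟨f, fun x hx ↦ hx f hf, hfa⟩

/-- The `k`-rational points of an affine variety over an extension `K` of `k` form an affine
variety over `k`: applying the `k`-linear functionals of `K` to the coefficients of a polynomial
over `K` gives polynomials over `k` with the same `k`-rational zeros. -/
theorem IsAffineVariety.rationalPoints {σ k K : Type*} [Field k] [Field K] [Algebra k K] [Finite σ]
    {V : Set (σ → K)} (hV : IsAffineVariety V) :
    IsAffineVariety {x : σ → k | (fun i ↦ algebraMap k K (x i)) ∈ V} := by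
  cases nonempty_fintype σ
  -- applying a functional to the coefficients commutes with evaluation at `k`-rational points
  have key (φ : Module.Dual k K) (f : MvPolynomial σ K) (x : σ → k) :
      eval x (∑ m ∈ f.support, monomial m (φ (coeff m f))) =
        φ (eval (fun i ↦ algebraMap k K (x i)) f) := by
    rw [map_sum, eval_eq', map_sum]
    refine Finset.sum_congr rfl fun m _ ↦ ?_
    rw [eval_monomial, Finsupp.prod_fintype _ _ (by simp), mul_comm (coeff m f)]
    simp_rw [← map_pow, ← map_prod]
    rw [← Algebra.smul_def, map_smul, smul_eq_mul, mul_comm]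
  refine isAffineVariety_of_separating fun a ha ↦ ?_
  obtain ⟨f, hfV, hfa⟩ := hV.exists_separating ha
  obtain ⟨φ, hφ⟩ : ∃ φ : Module.Dual k K, φ (eval (fun i ↦ algebraMap k K (a i)) f) ≠ 0 := by
    by_contra! h
    exact hfa ((Module.forall_dual_apply_eq_zero_iff k _).1 h)
  refine ⟨∑ m ∈ f.support, monomial m (φ (coeff m f)), fun x hx ↦ ?_, by rwa [key]⟩
  rw [key, hfV _ hx, map_zero]

/-! ### Elimination for families of cones -/

/-- A polynomial vanishing on a line through the origin has all its homogeneous components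
vanishing on it. -/
theorem eval_homogeneousComponent_eq_zero {τ K : Type*} [Field K] [Infinite K]
    {h : MvPolynomial τ K} {x : τ → K} (hx : ∀ t : K, eval (t • x) h = 0) (d : ℕ) :
    eval x (homogeneousComponent d h) = 0 := by
  classical
  let p : Polynomial K := ∑ i ∈ Finset.range (h.totalDegree + 1),
    Polynomial.monomial i (eval x (homogeneousComponent i h))
  have hp : p = 0 := by
    refine Polynomial.funext fun t ↦ ?_
    rw [Polynomial.eval_zero, ← hx t]
    conv_rhs => rw [← sum_homogeneousComponent h]
    rw [map_sum, Polynomial.eval_finsetSum]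
    refine Finset.sum_congr rfl fun i _ ↦ ?_
    have hi := homogeneousComponent_isHomogeneous i h
    rw [Polynomial.eval_monomial, eval_eq, eval_eq, Finset.sum_mul]
    refine Finset.sum_congr rfl fun m hm ↦ ?_
    have hd : ∏ j ∈ m.support, t ^ m j = t ^ i := by
      rw [Finset.prod_pow_eq_pow_sum, hi.degree_eq_sum_deg_support hm]
    simp only [Pi.smul_apply, smul_eq_mul, mul_pow, Finset.prod_mul_distrib, hd]
    ring
  by_cases hd : d < h.totalDegree + 1
  · have := congrArg (fun q ↦ Polynomial.coeff q d) hp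
    simpa [p, Polynomial.finsetSum_coeff, Polynomial.coeff_monomial, hd] using this
  · rw [homogeneousComponent_eq_zero d h (by omega), map_zero]

theorem map_homogeneousComponent {τ R S : Type*} [CommSemiring R] [CommSemiring S] (φ : R →+* S)
    (d : ℕ) (f : MvPolynomial τ R) :
    map φ (homogeneousComponent d f) = homogeneousComponent d (map φ f) := by
  ext m
  simp only [coeff_map, coeff_homogeneousComponent]
  split_ifs <;> simp

/-- The ideal of the polynomials in the variables `τ`, with coefficients that are polynomials in
the parameters `σ`, that vanish on `Z`. -/
noncomputable def relativeVanishingIdeal {σ τ K : Type*} [Field K] (Z : Set (σ ⊕ τ → K)) :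
    Ideal (MvPolynomial τ (MvPolynomial σ K)) where
  carrier := {f | ∀ a x, Sum.elim a x ∈ Z → eval x (map (eval a) f) = 0}
  zero_mem' := by simp
  add_mem' hf hg a x h := by rw [map_add, map_add, hf a x h, hg a x h, add_zero]
  smul_mem' c f hf a x h := by rw [smul_eq_mul, map_mul, map_mul, hf a x h, mul_zero]

/-- If the fibre over `a` of a closed family of cones is trivial, some power of the irrelevant
ideal lies in the fibre over `a` of the relative vanishing ideal. -/
theorem exists_pow_idealOfVars_le {σ τ K : Type*} [Field K] [IsAlgClosed K] [Finite σ] [Finite τ]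
    {Z : Set (σ ⊕ τ → K)} (hZ : IsAffineVariety Z) {a : σ → K}
    (ha : ∀ x, Sum.elim a x ∈ Z → x = 0) :
    ∃ D, idealOfVars τ K ^ D ≤ (relativeVanishingIdeal Z).map (map (eval a)) := by
  refine Ideal.exists_pow_le_of_le_radical_of_fg ?_ (idealOfVars_fg τ K)
  rw [← vanishingIdeal_zeroLocus_eq_radical (k := K) (K := K) (σ := τ)
    ((relativeVanishingIdeal Z).map (map (eval a))), Ideal.span_le]
  rintro _ ⟨i, rfl⟩ x hx
  suffices x = 0 by simp [this]
  refine ha x ?_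
  by_contra hxZ
  obtain ⟨f, hfZ, hfx⟩ := hZ.exists_separating hxZ
  -- `f` regarded as a polynomial in the variables `τ` over the polynomials in the parameters `σ`
  let F (g : MvPolynomial (σ ⊕ τ) K) : MvPolynomial τ (MvPolynomial σ K) :=
    aeval (Sum.elim (fun s ↦ C (X s)) X) g
  have key (g : MvPolynomial (σ ⊕ τ) K) (b : σ → K) (y : τ → K) :
      eval y (map (eval b) (F g)) = eval (Sum.elim b y) g := by
    induction g using MvPolynomial.induction_on with
    | C c => simp [F, MvPolynomial.algebraMap_apply]
    | add p q hp hq =>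
      simp only [F, map_add] at hp hq ⊢
      rw [hp, hq]
    | mul_X p s hp =>
      simp only [F, map_mul] at hp ⊢
      rw [hp]
      cases s <;> simp
  refine hfx ?_
  rw [← key, ← aeval_eq_eval]
  exact hx _ (Ideal.mem_map_of_mem _ fun b y hby ↦ by rw [key, hfZ _ hby])

/-- The main theorem of elimination theory, for cones: if `Z` is closed and stable under scaling the
variables `τ`, the parameters over which `Z` has a nonzero point form a closed set. -/
theorem IsAffineVariety.exists_ne_zero {σ τ K : Type*} [Field K] [IsAlgClosed K] [Finite σ]
    [Finite τ] {Z : Set (σ ⊕ τ → K)} (hZ : IsAffineVariety Z)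
    (hcone : ∀ a x, Sum.elim a x ∈ Z → ∀ t : K, Sum.elim a (t • x) ∈ Z) :
    IsAffineVariety {a : σ → K | ∃ x : τ → K, x ≠ 0 ∧ Sum.elim a x ∈ Z} := by
  classical
  cases nonempty_fintype τ
  refine isAffineVariety_of_separating fun a ha ↦ ?_
  obtain ⟨D, hD⟩ := exists_pow_idealOfVars_le hZ (a := a) fun x hx ↦ by
    by_contra hx0
    exact ha ⟨x, hx0, hx⟩
  let S : Finset (τ →₀ ℕ) := (Finsupp.finite_of_degree_eq D).toFinset
  have hS {m : τ →₀ ℕ} : m ∈ S ↔ m.degree = D := by simp [S]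
  -- each monomial of degree `D` is the specialization at `a` of a form vanishing on `Z`
  have hlift (m : S) : ∃ f ∈ relativeVanishingIdeal Z, f.IsHomogeneous D ∧
      map (eval a) f = monomial m.1 1 := by
    have hm : (monomial m.1 1 : MvPolynomial τ K) ∈ idealOfVars τ K ^ D :=
      (monomial_mem_pow_idealOfVars_iff D _ one_ne_zero).2 (hS.1 m.2).ge
    have hsurj : Function.Surjective (map (eval a) : MvPolynomial τ (MvPolynomial σ K) →+* _) :=
      map_surjective _ fun c ↦ ⟨C c, eval_C c⟩
    obtain ⟨f, hf, hfm⟩ := (Ideal.mem_map_iff_of_surjective _ hsurj).1 (hD hm)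
    refine ⟨homogeneousComponent D f, fun b x hbx ↦ ?_, homogeneousComponent_isHomogeneous D f, ?_⟩
    · rw [map_homogeneousComponent]
      exact eval_homogeneousComponent_eq_zero (fun t ↦ hf b _ (hcone b x hbx t)) D
    · rw [map_homogeneousComponent, hfm]
      exact homogeneousComponent_eq_self (isHomogeneous_monomial _ (hS.1 m.2))
  choose f hfI hfD hfa using hlift
  -- the coefficient matrix of these forms is the identity at `a`, and is singular wherever `Z` has
  -- a nonzero point, since the monomials of degree `D` at this point form a kernel vector
  let M : Matrix S S (MvPolynomial σ K) := Matrix.of fun m m' ↦ coeff m'.1 (f m)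
  have hM (b : σ → K) : eval b M.det = ((eval b).mapMatrix M).det := RingHom.map_det _ _
  refine ⟨M.det, fun b hb ↦ ?_, ?_⟩
  · obtain ⟨x, hx0, hbx⟩ := hb
    rw [hM]
    refine Matrix.exists_mulVec_eq_zero_iff.1 ⟨fun m ↦ ∏ i, x i ^ m.1 i, fun h0 ↦ ?_, ?_⟩
    · obtain ⟨i, hi⟩ := Function.ne_iff.1 hx0
      have := congrFun h0 ⟨Finsupp.single i D, hS.2 (by simp)⟩
      simp only [Pi.zero_apply, Finset.prod_eq_zero_iff] at this
      obtain ⟨j, -, hj⟩ := this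
      by_cases hij : i = j
      · subst hij
        exact hi (by simpa using eq_zero_of_pow_eq_zero hj)
      · simp [hij] at hj
    · funext m
      have h := hfI m b x hbx
      have hsub : (map (eval b) (f m)).support ⊆ S := fun d hd ↦ by
        have := ((hfD m).map (eval b)).degree_eq_sum_deg_support hd
        exact hS.2 this.symm
      rw [eval_eq', Finset.sum_subset hsub fun d _ hd ↦ by rw [notMem_support_iff.1 hd, zero_mul],
        ← Finset.sum_coe_sort] at h
      simp_rw [coeff_map] at h
      exact h
  · have h1 : (eval a).mapMatrix M = 1 := by
      ext m m'
      have := congrArg (coeff m'.1) (hfa m)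
      rw [coeff_map, coeff_monomial] at this
      rw [Matrix.one_apply]
      refine this.trans ?_
      simp only [Subtype.ext_iff]
    rw [hM, h1, Matrix.det_one]
    exact one_ne_zero

/-! ### Commuting distance at most three -/

theorem isScalar_iff_of_apply_eq_zero {n : ℕ} {k : Type*} [Field k]
    {A : Matrix (Fin n) (Fin n) k} {i : Fin n} (h : A i i = 0) : IsScalar A ↔ A = 0 := by
  refine ⟨?_, fun h ↦ ⟨0, by simp [h]⟩⟩
  rintro ⟨c, rfl⟩
  have : c = 0 := by simpa using h
  simp [this]

theorem isScalar_sub_smul_one_iff {n : ℕ} {k : Type*} [Field k]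
    {A : Matrix (Fin n) (Fin n) k} (c : k) : IsScalar (A - c • 1) ↔ IsScalar A := by
  constructor
  · rintro ⟨d, hd⟩
    exact ⟨d + c, by rw [add_smul, ← hd, sub_add_cancel]⟩
  · rintro ⟨d, rfl⟩
    exact ⟨d - c, by rw [sub_smul]⟩

theorem IsScalar.commute {n : ℕ} {k : Type*} [Field k] {A : Matrix (Fin n) (Fin n) k}
    (hA : IsScalar A) (B : Matrix (Fin n) (Fin n) k) : Commute A B := by
  obtain ⟨c, rfl⟩ := hA
  exact (Commute.one_left B).smul_left c

theorem exists_not_isScalar {n : ℕ} (hn : 2 ≤ n) (k : Type*) [Field k] :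
    ∃ A : Matrix (Fin n) (Fin n) k, ¬ IsScalar A := by
  let i : Fin n := ⟨0, by omega⟩
  let j : Fin n := ⟨1, by omega⟩
  have hij : i ≠ j := by simp [i, j]
  refine ⟨Matrix.single i j 1, ?_⟩
  rw [isScalar_iff_of_apply_eq_zero (i := i) (by simp [hij.symm])]
  intro h
  simpa using congrFun (congrFun h i) j

theorem commGraph_edist_le_one_iff {n : ℕ} {k : Type*} [Field k]
    {A B : {A : Matrix (Fin n) (Fin n) k // ¬ IsScalar A}} :
    (commGraph n k).edist A B ≤ 1 ↔ Commute A.1 B.1 := by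
  rw [SimpleGraph.edist_le_one_iff_adj_or_eq]
  constructor
  · rintro (h | rfl)
    exacts [h.2, Commute.refl _]
  · intro h
    by_cases hAB : A = B
    exacts [Or.inr hAB, Or.inl ⟨hAB, h⟩]

theorem commDist_le_three_iff {n : ℕ} (hn : 2 ≤ n) {k : Type*} [Field k]
    (A B : Matrix (Fin n) (Fin n) k) :
    commDist A B ≤ 3 ↔ ∃ X Y : Matrix (Fin n) (Fin n) k, ¬ IsScalar X ∧ ¬ IsScalar Y ∧
      Commute A X ∧ Commute X Y ∧ Commute Y B := by
  by_cases h : ¬ IsScalar A ∧ ¬ IsScalar B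
  · rw [commDist, dif_pos h]
    constructor
    · intro hd
      obtain ⟨w, hw⟩ := SimpleGraph.exists_walk_of_edist_ne_top
        (ne_top_of_le_ne_top (by simp : (3 : ℕ∞) ≠ ⊤) hd)
      have hw3 : w.length ≤ 3 := by
        rw [← hw] at hd
        exact_mod_cast hd
      -- consecutive entries of the walk, which stays at its end once it gets there, commute
      have hc (i : ℕ) : Commute (w.getVert i).1 (w.getVert (i + 1)).1 := by
        by_cases hi : i < w.length
        · exact (w.adj_getVert_succ hi).2
        · rw [w.getVert_of_length_le (by omega), w.getVert_of_length_le (by omega)]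
      have h0 := hc 0
      have h2 := hc 2
      rw [w.getVert_zero] at h0
      rw [w.getVert_of_length_le (by omega : w.length ≤ 2 + 1)] at h2
      exact ⟨_, _, (w.getVert 1).2, (w.getVert 2).2, h0, hc 1, h2⟩
    · rintro ⟨X, Y, hX, hY, hAX, hXY, hYB⟩
      have h1 := commGraph_edist_le_one_iff (A := ⟨A, h.1⟩) (B := ⟨X, hX⟩) |>.2 hAX
      have h2 := commGraph_edist_le_one_iff (A := ⟨X, hX⟩) (B := ⟨Y, hY⟩) |>.2 hXY
      have h3 := commGraph_edist_le_one_iff (A := ⟨Y, hY⟩) (B := ⟨B, h.2⟩) |>.2 hYB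
      calc _ ≤ _ := SimpleGraph.edist_triangle (v := ⟨X, hX⟩)
        _ ≤ 1 + (1 + 1) := add_le_add h1 (SimpleGraph.edist_triangle.trans (add_le_add h2 h3))
        _ = 3 := by norm_num
  · have hle : commDist A B ≤ 3 := by
      rw [commDist, dif_neg h]
      split_ifs <;> norm_num
    refine iff_of_true hle ?_
    obtain ⟨X, hX⟩ := exists_not_isScalar hn k
    by_cases hA : IsScalar A
    · by_cases hB : IsScalar B
      · exact ⟨X, X, hX, hX, hA.commute X, Commute.refl X, (hB.commute X).symm⟩
      · exact ⟨B, B, hB, hB, hA.commute B, Commute.refl B, Commute.refl B⟩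
    · have hB : IsScalar B := by tauto
      exact ⟨A, A, hA, hA, Commute.refl A, Commute.refl A, (hB.commute A).symm⟩

theorem IsAffineVariety.inter {σ k : Type*} [Field k] {V W : Set (σ → k)}
    (hV : IsAffineVariety V) (hW : IsAffineVariety W) : IsAffineVariety (V ∩ W) := by
  classical
  obtain ⟨F, rfl⟩ := hV
  obtain ⟨G, rfl⟩ := hW
  refine ⟨F ∪ G, ?_⟩
  ext x
  simp only [Set.mem_inter_iff, Set.mem_ofPred_eq, Finset.mem_union, or_imp, forall_and]

theorem isAffineVariety_setOf_apply_eq_zero {σ k : Type*} [Field k] (s : σ) :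
    IsAffineVariety {x : σ → k | x s = 0} :=
  ⟨{X s}, by simp⟩

/-- Commutation is a closed condition on two matrices whose entries are distinguished coordinates
of an affine space. -/
theorem isAffineVariety_setOf_commute {m σ k : Type*} [Fintype m] [Field k] [Finite σ]
    (e f : m × m → σ) :
    IsAffineVariety {x : σ → k |
      Commute (Matrix.of fun i j ↦ x (e (i, j))) (Matrix.of fun i j ↦ x (f (i, j)))} := by
  convert isAffineVariety_setOf_forall (k := k) fun ij : m × m ↦
    ∑ l, (X (e (ij.1, l)) * X (f (l, ij.2)) - X (f (ij.1, l)) * X (e (l, ij.2)) :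
      MvPolynomial σ k) using 1
  ext x
  simp [Commute, SemiconjBy, ← Matrix.ext_iff, Matrix.mul_apply, sub_eq_zero]

/-- The quadruples `(A, B, X, Y)` in which consecutive terms of the sequence `A, X, Y, B` commute
and `X` and `Y` are normalized to have a zero entry at `(i, i)`, as a subset of an affine space. -/
def commutingChains (n : ℕ) (k : Type*) [Field k] (i : Fin n) :
    Set ((PairIndex n ⊕ Fin n × Fin n) ⊕ Fin n × Fin n → k) :=
  {z | Commute (Matrix.of fun r s ↦ z (Sum.inl (Sum.inl (Sum.inl (r, s)))))
      (Matrix.of fun r s ↦ z (Sum.inl (Sum.inr (r, s))))} ∩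
  ({z | Commute (Matrix.of fun r s ↦ z (Sum.inl (Sum.inr (r, s))))
      (Matrix.of fun r s ↦ z (Sum.inr (r, s)))} ∩
  ({z | Commute (Matrix.of fun r s ↦ z (Sum.inr (r, s)))
      (Matrix.of fun r s ↦ z (Sum.inl (Sum.inl (Sum.inr (r, s)))))} ∩
  ({z | z (Sum.inl (Sum.inr (i, i))) = 0} ∩ {z | z (Sum.inr (i, i)) = 0})))

theorem isAffineVariety_commutingChains (n : ℕ) (k : Type*) [Field k] (i : Fin n) :
    IsAffineVariety (commutingChains n k i) :=
  (isAffineVariety_setOf_commute (fun p ↦ Sum.inl (Sum.inl (Sum.inl p)))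
      fun p ↦ Sum.inl (Sum.inr p)).inter <|
    (isAffineVariety_setOf_commute (fun p ↦ Sum.inl (Sum.inr p)) Sum.inr).inter <|
    (isAffineVariety_setOf_commute Sum.inr fun p ↦ Sum.inl (Sum.inl (Sum.inr p))).inter <|
    (isAffineVariety_setOf_apply_eq_zero _).inter (isAffineVariety_setOf_apply_eq_zero _)

theorem mem_commutingChains {n : ℕ} {k : Type*} [Field k] {i : Fin n} {a : PairIndex n → k}
    {x y : Fin n × Fin n → k} :
    Sum.elim (Sum.elim a x) y ∈ commutingChains n k i ↔
      Commute ((pairCoords n k).symm a).1 (Matrix.of (Function.curry x)) ∧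
      Commute (Matrix.of (Function.curry x)) (Matrix.of (Function.curry y)) ∧
      Commute (Matrix.of (Function.curry y)) ((pairCoords n k).symm a).2 ∧
      x (i, i) = 0 ∧ y (i, i) = 0 :=
  Iff.rfl

theorem of_curry_smul {m k : Type*} [Field k] (t : k) (x : m × m → k) :
    Matrix.of (Function.curry (t • x)) = t • Matrix.of (Function.curry x) :=
  rfl

/-- Subtracting a scalar matrix from `X` and `Y` makes their `(i, i)` entries zero, after which
being non-scalar means being nonzero. -/
theorem pairCoords_mem_image_commSet_iff {n : ℕ} (hn : 2 ≤ n) {k : Type*} [Field k] (i : Fin n)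
    (a : PairIndex n → k) :
    a ∈ pairCoords n k '' commSet n k 3 ↔
      ∃ x, x ≠ 0 ∧ ∃ y, y ≠ 0 ∧ Sum.elim (Sum.elim a x) y ∈ commutingChains n k i := by
  rw [Equiv.image_eq_preimage_symm, Set.mem_preimage]
  have h0 {x : Fin n × Fin n → k} (hx : x (i, i) = 0) :
      ¬ IsScalar (Matrix.of (Function.curry x)) ↔ x ≠ 0 := by
    rw [isScalar_iff_of_apply_eq_zero (i := i) hx, not_iff_not]
    exact ⟨fun h ↦ funext fun p ↦ congrFun (congrFun h p.1) p.2, fun h ↦ h ▸ rfl⟩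
  refine (commDist_le_three_iff hn _ _).trans ⟨?_, ?_⟩
  · rintro ⟨X, Y, hX, hY, h1, h2, h3⟩
    have hdiag (M : Matrix (Fin n) (Fin n) k) : (M - M i i • 1) i i = 0 := by simp
    have hsc (c : k) (M : Matrix (Fin n) (Fin n) k) : Commute (c • 1) M :=
      (Commute.one_left M).smul_left c
    rw [← isScalar_sub_smul_one_iff (X i i)] at hX
    rw [← isScalar_sub_smul_one_iff (Y i i)] at hY
    refine ⟨Function.uncurry (X - X i i • 1 : Matrix (Fin n) (Fin n) k), (h0 (hdiag X)).1 hX,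
      Function.uncurry (Y - Y i i • 1 : Matrix (Fin n) (Fin n) k), (h0 (hdiag Y)).1 hY,
      mem_commutingChains.2 ⟨h1.sub_right (hsc _ _).symm,
        (h2.sub_left (hsc _ _)).sub_right (hsc _ _).symm, h3.sub_left (hsc _ _),
        hdiag X, hdiag Y⟩⟩
  · rintro ⟨x, hx, y, hy, h⟩
    obtain ⟨h1, h2, h3, hxi, hyi⟩ := mem_commutingChains.1 h
    exact ⟨_, _, (h0 hxi).2 hx, (h0 hyi).2 hy, h1, h2, h3⟩

theorem isAffineVariety_commSet_three {n : ℕ} (hn : 2 ≤ n) (K : Type*) [Field K] [IsAlgClosed K] :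
    IsAffineVariety (pairCoords n K '' commSet n K 3) := by
  let i : Fin n := ⟨0, by omega⟩
  have hY := (isAffineVariety_commutingChains n K i).exists_ne_zero fun b y h t ↦ by
    obtain ⟨a, x, rfl⟩ : ∃ a x, b = Sum.elim a x := ⟨_, _, (Sum.elim_comp_inl_inr b).symm⟩
    rw [mem_commutingChains] at h ⊢
    obtain ⟨h1, h2, h3, hx, hy⟩ := h
    rw [of_curry_smul]
    exact ⟨h1, h2.smul_right t, h3.smul_left t, hx, by simp [hy]⟩
  have hX := hY.exists_ne_zero fun a x h t ↦ by
    obtain ⟨y, hy0, h⟩ := h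
    refine ⟨y, hy0, ?_⟩
    rw [mem_commutingChains] at h ⊢
    obtain ⟨h1, h2, h3, hx, hy⟩ := h
    rw [of_curry_smul]
    exact ⟨h1.smul_right t, h2.smul_left t, h3, by simp [hx], hy⟩
  convert hX using 1
  ext a
  exact pairCoords_mem_image_commSet_iff hn i a

end CommDist

theorem mainTheorem11 (k : Type*) [Field k] (n : ℕ) (hn : 3 ≤ n)
    (hdist : ∀ A B : Matrix (Fin n) (Fin n) k,
      CommDist.commDist A B =
        CommDist.commDist (A.map (algebraMap k (AlgebraicClosure k)))
          (B.map (algebraMap k (AlgebraicClosure k)))) :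
    CommDist.IsAffineVariety (CommDist.pairCoords n k '' CommDist.commSet n k 3) ∧
      CommDist.commSet n k 3 =
        {P | (P.1.map (algebraMap k (AlgebraicClosure k)),
              P.2.map (algebraMap k (AlgebraicClosure k))) ∈
            CommDist.commSet n (AlgebraicClosure k) 3} := by
  have hset : CommDist.commSet n k 3 =
      {P | (P.1.map (algebraMap k (AlgebraicClosure k)),
            P.2.map (algebraMap k (AlgebraicClosure k))) ∈
          CommDist.commSet n (AlgebraicClosure k) 3} := by
    ext ⟨A, B⟩
    simp only [CommDist.commSet, Set.mem_ofPred_eq, hdist A B]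
  refine ⟨?_, hset⟩
  convert (CommDist.isAffineVariety_commSet_three (by omega : 2 ≤ n)
    (AlgebraicClosure k)).rationalPoints (k := k) using 1
  ext a
  rw [hset, Equiv.image_eq_preimage_symm, Equiv.image_eq_preimage_symm]
  exact Iff.rfl
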